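/- Let $n,k,d$ be integers with $1\le k\le d\le n-2$, put $s=d+1-k$, and let $F$ be a finite field with $|F|\ge sn$. Let $\{\lambda_{i,j}: 1\le i\le n,\ 0\le j\le s-1\}$ be any $sn$ distinct elements of $F$ (such elements exist). For $a\in\{0,\dots,s^n-1\}$ let $(a_1,\dots,a_n)$ denote its $s$-ary digits. Let $\mathcal C$ be the code of all $C=(C_1,\dots,C_n)$ with nodes $C_i=(c_{i,b,a}: 1\le b\le d+2-k,\ 0\le a\le s^n-1)\in F^l$, of node size $l=(d+2-k)s^n$, that satisfy $$\sum_{i=1}^n \lambda_{i,a_i}^t c_{i,b,a}=0\qquad\text{for all } 0\le t\le n-k-1,\ 1\le b\le d+2-k,\ 0\le a\le s^n-1 .$$ For disjoint sets $\mathcal F,\mathcal R\subseteq\{1,\dots,n\}$ of failed nodes and helper nodes, a cooperative repair scheme consists of the following: every failed node downloads from every helper node some number of symbols of $F$, computed from the content of that helper node; then, in finitely many rounds, the failed nodes send each other symbols of $F$, each message being a function of what its sender has received in the earlier steps; at the end the content $C_i$ of each failed node $i\in\mathcal F$ is, for every codeword of $\mathcal C$, a function of what node $i$ has received. Let $N_{\mathrm{co}}(\mathcal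 C,\mathcal F,\mathcal R)$ be the smallest total number of symbols of $F$ transmitted in such a scheme. Then $\mathcal C$ is a $(2,d)$-MSR code under the cooperative model, that is: 1. $\mathcal C$ is an $(n,k,l)$ MDS array code: it has dimension $kl$ over $F$, and the contents of any $k$ of the $n$ nodes determine the codeword; 2. for all disjoint $\mathcal F,\mathcal R$ with $|\mathcal F|=2$ and $|\mathcal R|=d$, the cooperative cut-set bound is met with equality: $$N_{\mathrm{co}}(\mathcal C,\mathcal F,\mathcal R)=\frac{|\mathcal F|(|\mathcal R|+|\mathcal F|-1)\,l}{|\mathcal F|+|\mathcal R|-k}=2(d+1)s^n .$$ -/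

import Mathlib

namespace CoopMSR

/-- An `(n, k, l)` MDS array code over `F`, where the coordinates of a node are indexed by the
finite type `ι` (so that the node size is `l = |ι|` and a node is a vector in `ι → F`): the code
has `k` nodes worth of information, and the contents of any `k` nodes determine the codeword. -/
structure IsMDSArrayCode {F : Type*} [Field F] {n : ℕ} {ι : Type*} [Fintype ι]
    (C : Submodule F (Fin n → ι → F)) (k : ℕ) : Prop where
  le_length : k ≤ n
  finrank_eq : Module.finrank F C = k * Fintype.card ι
  recover : ∀ S : Finset (Fin n), S.card = k →
    ∀ c ∈ C, ∀ c' ∈ C, (∀ i ∈ S, c i = c' i) → c = c'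

/-- The data of a cooperative repair procedure. Node `i` downloads `helperSize j i` symbols from
the helper node `j`, computed from the content of `j` alone. Then, in rounds
`0, …, rounds - 1`, the failed nodes exchange data: in round `t` the failed node `i'` sends
`exchangeSize t i' i` symbols to the failed node `i`; `exchange t i' i c` is the message that is
sent when the stored codeword is `c`. All the messages may be arbitrary (nonlinear) functions. -/
structure CoopScheme (F : Type*) (n : ℕ) (ι : Type*) where
  helperSize : Fin n → Fin n → ℕ
  download : ∀ j i : Fin n, (ι → F) → (Fin (helperSize j i) → F)
  rounds : ℕ
  exchangeSize : ℕ → Fin n → Fin n → ℕ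
  exchange : ∀ (t : ℕ) (i' i : Fin n), (Fin n → ι → F) → (Fin (exchangeSize t i' i) → F)

/-- For the codewords `c` and `c'`, the failed node `i` has received the same data, from all the
helper nodes and from the other failed nodes, before round `t`. -/
def CoopScheme.SameView {F : Type*} {n : ℕ} {ι : Type*} (P : CoopScheme F n ι)
    (failed helpers : Finset (Fin n)) (t : ℕ) (i : Fin n) (c c' : Fin n → ι → F) : Prop :=
  (∀ j ∈ helpers, P.download j i (c j) = P.download j i (c' j)) ∧
  ∀ t' < t, ∀ i' ∈ failed, i' ≠ i → P.exchange t' i' i c = P.exchange t' i' i c'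

/-- The scheme repairs the nodes in `failed` from the nodes in `helpers`, for the code `C`:
whatever a failed node sends is a function of the data it has received in earlier rounds, and the
content of each failed node is a function of all the data it has received at the end. -/
structure CoopScheme.Repairs {F : Type*} [Field F] {n : ℕ} {ι : Type*} (P : CoopScheme F n ι)
    (C : Submodule F (Fin n → ι → F)) (failed helpers : Finset (Fin n)) : Prop where
  causal : ∀ t < P.rounds, ∀ i' ∈ failed, ∀ i ∈ failed, i ≠ i' → ∀ c ∈ C, ∀ c' ∈ C,
    P.SameView failed helpers t i' c c' → P.exchange t i' i c = P.exchange t i' i c'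
  recover : ∀ i ∈ failed, ∀ c ∈ C, ∀ c' ∈ C,
    P.SameView failed helpers P.rounds i c c' → c i = c' i

/-- The total number of symbols that are transmitted between different nodes. -/
def CoopScheme.bandwidth {F : Type*} {n : ℕ} {ι : Type*} (P : CoopScheme F n ι)
    (failed helpers : Finset (Fin n)) : ℕ :=
  (∑ i ∈ failed, ∑ j ∈ helpers, P.helperSize j i) +
    ∑ t ∈ Finset.range P.rounds, ∑ i ∈ failed, ∑ i' ∈ failed.erase i, P.exchangeSize t i' i

/-- `N` is the cooperative repair bandwidth of `C` for the given sets of failed nodes and helper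
nodes: the smallest number of symbols with which the repair is possible. -/
def IsCoopRepairBandwidth {F : Type*} [Field F] {n : ℕ} {ι : Type*}
    (C : Submodule F (Fin n → ι → F)) (failed helpers : Finset (Fin n)) (N : ℕ) : Prop :=
  IsLeast {m : ℕ | ∃ P : CoopScheme F n ι,
    P.Repairs C failed helpers ∧ P.bandwidth failed helpers = m} N

/-- `(h, d)`-MSR codes (of dimension `k`) under the cooperative model: MDS array codes that meet
the cooperative cut-set bound with equality for all sets of `h` failed nodes and `d` helpers. -/
structure IsCoopMSR {F : Type*} [Field F] {n : ℕ} {ι : Type*} [Fintype ι]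
    (C : Submodule F (Fin n → ι → F)) (k h d : ℕ) : Prop where
  isMDS : IsMDSArrayCode C k
  optimal : ∀ failed helpers : Finset (Fin n), Disjoint failed helpers →
    failed.card = h → helpers.card = d →
    ∃ N : ℕ, IsCoopRepairBandwidth C failed helpers N ∧
      (N : ℚ) = (h : ℚ) * ((d : ℚ) + h - 1) * Fintype.card ι / ((h : ℚ) + d - k)

/-- Coordinates of a node: pairs `(b, a)` of a replica index `b` (`d + 2 - k` values) and an
integer `0 ≤ a < s ^ n`, given by its `n` digits in base `s = d + 1 - k`. -/
abbrev NodeIndex (n k d : ℕ) : Type := Fin (d + 2 - k) × (Fin n → Fin (d + 1 - k))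

/-- The code defined by the parity checks `∑ i, λ_{i, a_i} ^ t * c_{i, b, a} = 0` for all
`0 ≤ t ≤ n - k - 1` and all `b` and `a`. -/
def replicatedCode {F : Type*} [Field F] (n k d : ℕ) (lam : Fin n → Fin (d + 1 - k) → F) :
    Submodule F (Fin n → NodeIndex n k d → F) where
  carrier := {c | ∀ t < n - k, ∀ (b : Fin (d + 2 - k)) (a : Fin n → Fin (d + 1 - k)),
    ∑ i, lam i (a i) ^ t * c i (b, a) = 0}
  add_mem' := by
    intro x y hx hy t ht b a
    simp only [Pi.add_apply, mul_add, Finset.sum_add_distrib, hx t ht b a, hy t ht b a, add_zero]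
  zero_mem' := by
    intro t _ b a
    simp
  smul_mem' := by
    intro r x hx t ht b a
    simp only [Pi.smul_apply, smul_eq_mul, mul_left_comm _ r, ← Finset.mul_sum, hx t ht b a,
      mul_zero]

end CoopMSR

/-! Put `s = d + 1 - k`. Lower bound: any `k` nodes of an MDS code carry independent contents, so
data crossing a cut must take as many values as the nodes they determine. One cut isolates a failed
node with `k - 1` helpers, another isolates both failed nodes with `k - 2` helpers. Averaging each
over the choice of helpers and combining them linearly gives `CoopScheme.Repairs.cutSet_bound`.

Upper bound: fix a failed node `p`, leave out one of the `s + 1` replicas, shift the `p`-th digit in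
each other replica by its index and add the parity checks. The coefficient of a node `i ≠ p` does
not involve the shifted digit, so its symbols merge into one sum, while `p` contributes `s` symbols
with distinct coefficients. With `d` merged sums downloaded, `s + (n - 1 - d) = n - k` unknowns
remain in a Vandermonde system (`eq_zero_of_mix_eq_zero`). Thus `p` learns all but one of its
replicas, and also the merged sum of the other failed node. If the two failed nodes omit different
replicas, exchanging these sums supplies what is missing (`mixScheme_repairs`). -/

namespace CoopMSR

open Finset

/-! ### Vandermonde systems -/

section Vandermonde

variable {F κ : Type*} [Field F]

/-- A nonzero vector in the kernel of a Vandermonde matrix with `r` rows and distinct nodes has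
more than `r` nonzero coordinates. -/
theorem eq_zero_of_sum_pow_mul_eq_zero [DecidableEq κ] {V : Finset κ} {x y : κ → F} {r : ℕ}
    (hx : Set.InjOn x V) (hV : #V ≤ r) (h : ∀ t < r, ∑ i ∈ V, x i ^ t * y i = 0) :
    ∀ i ∈ V, y i = 0 := by
  intro i hi
  have hpoly : ∀ p : Polynomial F, p.natDegree < r → ∑ j ∈ V, p.eval (x j) * y j = 0 := by
    intro p hp
    simp only [Polynomial.eval_eq_sum_range' hp, Finset.sum_mul]
    rw [Finset.sum_comm]
    refine Finset.sum_eq_zero fun t ht => ?_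
    simp only [mul_assoc, ← Finset.mul_sum, h t (Finset.mem_range.1 ht), mul_zero]
  -- Testing against the polynomial that vanishes at all nodes of `V` except `x i` isolates `y i`.
  have hdeg : (∏ j ∈ V.erase i, (Polynomial.X - Polynomial.C (x j))).natDegree < r := by
    rw [Polynomial.natDegree_prod_of_monic _ _ fun j _ => Polynomial.monic_X_sub_C _]
    simp only [Polynomial.natDegree_X_sub_C, Finset.sum_const, smul_eq_mul, mul_one]
    exact (Finset.card_erase_lt_of_mem hi).trans_le hV
  have hsum := hpoly _ hdeg
  rw [Finset.sum_eq_single i] at hsum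
  · refine (mul_eq_zero.1 hsum).resolve_left ?_
    rw [Polynomial.eval_prod]
    refine Finset.prod_ne_zero_iff.2 fun j hj => ?_
    simp only [Polynomial.eval_sub, Polynomial.eval_X, Polynomial.eval_C, sub_ne_zero]
    intro hij
    exact Finset.ne_of_mem_erase hj (hx hi (Finset.mem_of_mem_erase hj) hij).symm
  · intro j hj hji
    rw [Polynomial.eval_prod, Finset.prod_eq_zero (Finset.mem_erase.2 ⟨hji, hj⟩) (by simp),
      zero_mul]
  · exact fun hi' => absurd hi hi'

end Vandermonde

theorem eq_and_eq_of_uncurry_injective {α β γ : Type*} {f : α → β → γ}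
    (hf : Function.Injective (Function.uncurry f)) {i j : α} {u v : β} (h : f i u = f j v) :
    i = j ∧ u = v :=
  Prod.ext_iff.1 (@hf (i, u) (j, v) h)

/-! ### Averaging over subsets -/

/-- If all `m`-element subsets of `R` have weight at least `L`, then `R` has weight at least
`|R| * L / m`. -/
theorem card_mul_le_mul_sum_of_forall_subset {α : Type*} [DecidableEq α] (w : α → ℕ) (L m : ℕ)
    (hm : 0 < m) (R : Finset α) (hR : m ≤ #R)
    (h : ∀ U ⊆ R, #U = m → L ≤ ∑ j ∈ U, w j) : #R * L ≤ m * ∑ j ∈ R, w j := by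
  induction hN : #R - m generalizing R with
  | zero =>
    have hRm : #R = m := by omega
    rw [hRm]
    exact Nat.mul_le_mul_left _ (h R subset_rfl hRm)
  | succ N ih =>
    have hstep : ∀ j ∈ R, (#R - 1) * L ≤ m * ∑ i ∈ R.erase j, w i := by
      intro j hj
      have hc := Finset.card_erase_of_mem hj
      rw [← hc]
      exact ih _ (by omega) (fun U hU => h U (hU.trans (Finset.erase_subset _ _))) (by omega)
    have hsum := Finset.sum_le_sum hstep
    obtain ⟨D, hD⟩ : ∃ D, #R = D + 1 := ⟨#R - 1, by omega⟩
    -- Over all ways to delete one element, each weight is counted `#R - 1` times.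
    have herase : ∑ j ∈ R, ∑ i ∈ R.erase j, w i + ∑ j ∈ R, w j = #R * ∑ j ∈ R, w j := by
      rw [← Finset.sum_add_distrib, ← smul_eq_mul, ← Finset.sum_const]
      exact Finset.sum_congr rfl fun j hj => Finset.sum_erase_add _ _ hj
    rw [Finset.sum_const, smul_eq_mul] at hsum
    rw [hD] at herase hsum ⊢
    have hDpos : 0 < D := by omega
    have herase' : ∑ j ∈ R, ∑ i ∈ R.erase j, w i = D * ∑ j ∈ R, w j := by linarith
    rw [← Finset.mul_sum, herase', Nat.add_sub_cancel] at hsum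
    refine Nat.le_of_mul_le_mul_left ?_ hDpos
    linarith

/-! ### The cooperative cut-set bound -/

section CutSet

variable {F : Type*} [Field F] {n : ℕ} {ι : Type*}
  {C : Submodule F (Fin n → ι → F)} {k : ℕ}

/-- The contents of any `k` nodes of an MDS array code can be prescribed. -/
theorem IsMDSArrayCode.exists_extension [Fintype ι] (hC : IsMDSArrayCode C k) {S : Finset (Fin n)}
    (hS : #S = k) (y : Fin n → ι → F) : ∃ c ∈ C, ∀ i ∈ S, c i = y i := by
  let f : C →ₗ[F] (S → ι → F) :=
    (LinearMap.funLeft F (ι → F) (Subtype.val : S → Fin n)).comp C.subtype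
  have hf : Function.Injective f := by
    intro c c' hcc
    exact Subtype.ext (hC.recover S hS _ c.2 _ c'.2 fun i hi => congrFun hcc ⟨i, hi⟩)
  have hdim : Module.finrank F C = Module.finrank F (S → ι → F) := by
    rw [hC.finrank_eq, Module.finrank_pi_fintype]
    simp [hS]
  obtain ⟨c, hc⟩ := (LinearMap.injective_iff_surjective_of_finrank_eq_finrank hdim).1 hf
    fun i => y i
  exact ⟨c, c.2, fun i hi => congrFun hc ⟨i, hi⟩⟩

/-- Data that determine the nodes in `W`, for the codewords that vanish on `T`, take at least as
many values as the nodes in `W` do. -/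
theorem IsMDSArrayCode.pow_le_card [Fintype F] [Fintype ι] (hC : IsMDSArrayCode C k)
    {T W : Finset (Fin n)}
    (hTW : Disjoint T W) (hcard : #T + #W = k) {X : Type*} [Fintype X]
    (φ : (Fin n → ι → F) → X)
    (hφ : ∀ c ∈ C, ∀ c' ∈ C, (∀ i ∈ T, c i = c' i) → φ c = φ c' → ∀ i ∈ W, c i = c' i) :
    Fintype.card F ^ (#W * Fintype.card ι) ≤ Fintype.card X := by
  classical
  -- Codewords that vanish on `T` still realize every content of `W`, so `φ` must separate `|F| ^
  -- (#W * l)` of them.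
  have hex : ∀ y : W → ι → F, ∃ c ∈ C, (∀ i ∈ T, c i = 0) ∧ ∀ i : W, c i = y i := by
    intro y
    obtain ⟨c, hc, h⟩ := hC.exists_extension
      (by rw [Finset.card_union_of_disjoint hTW, hcard] : #(T ∪ W) = k)
      fun i => if hi : i ∈ W then y ⟨i, hi⟩ else 0
    refine ⟨c, hc, fun i hi => ?_, fun i => ?_⟩
    · rw [h i (Finset.mem_union_left _ hi), dif_neg (Finset.disjoint_left.1 hTW hi)]
    · rw [h i (Finset.mem_union_right _ i.2), dif_pos i.2]
  choose g hgC hgT hgW using hex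
  have hinj : Function.Injective fun y => φ (g y) := by
    intro y y' hyy
    funext i
    rw [← hgW y i, ← hgW y' i]
    exact hφ _ (hgC y) _ (hgC y') (fun j hj => by rw [hgT y j hj, hgT y' j hj]) hyy i i.2
  have := Fintype.card_le_of_injective _ hinj
  simpa [← pow_mul, mul_comm] using this

variable {P : CoopScheme F n ι} {failed helpers : Finset (Fin n)}

/-- If all the downloads agree, then so do the views of all the failed nodes. -/
theorem CoopScheme.Repairs.sameView_of_download_eq (hP : P.Repairs C failed helpers)
    {c c' : Fin n → ι → F} (hc : c ∈ C) (hc' : c' ∈ C)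
    (h : ∀ i ∈ failed, ∀ j ∈ helpers, P.download j i (c j) = P.download j i (c' j))
    {t : ℕ} (ht : t ≤ P.rounds) :
    ∀ i ∈ failed, P.SameView failed helpers t i c c' := by
  induction t with
  | zero => exact fun i hi => ⟨h i hi, fun t' ht' => absurd ht' (Nat.not_lt_zero _)⟩
  | succ t ih =>
    intro i hi
    refine ⟨h i hi, fun t' ht' i' hi' hne => ?_⟩
    rcases Nat.lt_succ_iff_lt_or_eq.1 ht' with hlt | rfl
    · exact (ih (by omega) i hi).2 t' hlt i' hi' hne
    · exact hP.causal t' (by omega) i' hi' i hi hne.symm c hc c' hc' (ih (by omega) i' hi')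

/-- The cut around one failed node and `k - 1` helper nodes. -/
theorem CoopScheme.Repairs.card_le_sum_of_card_sdiff [Fintype F] [Fintype ι]
    (hC : IsMDSArrayCode C k)
    (hP : P.Repairs C failed helpers) (hdisj : Disjoint failed helpers)
    {p : Fin n} (hp : p ∈ failed) {U : Finset (Fin n)}
    (hcard : #(helpers \ U) + 1 = k) :
    Fintype.card ι ≤ ∑ j ∈ U, P.helperSize j p +
      ∑ t ∈ range P.rounds, ∑ i' ∈ failed.erase p, P.exchangeSize t i' p := by
  classical
  have hphelp : p ∉ helpers := Finset.disjoint_left.1 hdisj hp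
  have key := hC.pow_le_card (T := helpers \ U) (W := {p})
    (by simp [hphelp]) (by simpa using hcard)
    (X := (∀ j : U, Fin (P.helperSize j p) → F) ×
      (∀ t : range P.rounds, ∀ i' : failed.erase p, Fin (P.exchangeSize t i' p) → F))
    (fun c => (fun j => P.download j p (c j), fun t i' => P.exchange t i' p c)) (by
      intro c hc c' hc' hT hφ i hi
      obtain rfl := Finset.mem_singleton.1 hi
      rw [Prod.ext_iff] at hφ
      refine hP.recover i hp c hc c' hc' ⟨fun j hj => ?_, fun t ht i' hi' hne => ?_⟩
      · by_cases hjU : j ∈ U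
        · exact congrFun hφ.1 ⟨j, hjU⟩
        · rw [hT j (Finset.mem_sdiff.2 ⟨hj, hjU⟩)]
      · exact congrFun (congrFun hφ.2 ⟨t, Finset.mem_range.2 ht⟩)
          ⟨i', Finset.mem_erase.2 ⟨hne, hi'⟩⟩)
  have hX : Fintype.card ((∀ j : U, Fin (P.helperSize j p) → F) ×
      (∀ t : range P.rounds, ∀ i' : failed.erase p, Fin (P.exchangeSize t i' p) → F)) =
      Fintype.card F ^ (∑ j ∈ U, P.helperSize j p +
        ∑ t ∈ range P.rounds, ∑ i' ∈ failed.erase p, P.exchangeSize t i' p) := by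
    simp only [Fintype.card_prod, Fintype.card_pi, Finset.prod_const, Finset.card_univ,
      Fintype.card_fin, Finset.prod_pow_eq_pow_sum, pow_add]
    rw [Finset.sum_coe_sort U fun j => P.helperSize j p,
      Finset.sum_coe_sort (range P.rounds) fun t => ∑ i' : failed.erase p, P.exchangeSize t i' p]
    simp only [fun t => Finset.sum_coe_sort (failed.erase p) fun i' => P.exchangeSize t i' p]
  rw [hX, Finset.card_singleton, one_mul] at key
  exact (Nat.pow_le_pow_iff_right Fintype.one_lt_card).1 key

/-- The cut around all the failed nodes and as many helper nodes as to make `k` nodes. -/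
theorem CoopScheme.Repairs.card_mul_le_sum_of_card_sdiff [Fintype F] [Fintype ι]
    (hC : IsMDSArrayCode C k)
    (hP : P.Repairs C failed helpers) (hdisj : Disjoint failed helpers)
    {U : Finset (Fin n)} (hcard : #(helpers \ U) + #failed = k) :
    #failed * Fintype.card ι ≤ ∑ j ∈ U, ∑ i ∈ failed, P.helperSize j i := by
  classical
  have key := hC.pow_le_card (T := helpers \ U) (W := failed)
    (hdisj.symm.mono_left Finset.sdiff_subset) hcard
    (X := ∀ j : U, ∀ i : failed, Fin (P.helperSize j i) → F)
    (fun c j i => P.download j i (c j)) (by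
      intro c hc c' hc' hT hφ i hi
      refine hP.recover i hi c hc c' hc'
        (hP.sameView_of_download_eq hc hc' (fun i hi j hj => ?_) le_rfl i hi)
      by_cases hjU : j ∈ U
      · exact congrFun (congrFun hφ ⟨j, hjU⟩) ⟨i, hi⟩
      · rw [hT j (Finset.mem_sdiff.2 ⟨hj, hjU⟩)])
  have hX : Fintype.card (∀ j : U, ∀ i : failed, Fin (P.helperSize j i) → F) =
      Fintype.card F ^ (∑ j ∈ U, ∑ i ∈ failed, P.helperSize j i) := by
    simp only [Fintype.card_pi, Finset.prod_const, Finset.card_univ,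
      Fintype.card_fin, Finset.prod_pow_eq_pow_sum]
    rw [Finset.sum_coe_sort U fun j => ∑ i : failed, P.helperSize j i]
    simp only [fun j => Finset.sum_coe_sort failed fun i => P.helperSize j i]
  rw [hX] at key
  exact (Nat.pow_le_pow_iff_right Fintype.one_lt_card).1 key

/-- The cooperative cut-set bound for two failed nodes. -/
theorem CoopScheme.Repairs.cutSet_bound [Fintype F] [Fintype ι] {d : ℕ}
    (hC : IsMDSArrayCode C k)
    (hP : P.Repairs C failed helpers) (hdisj : Disjoint failed helpers)
    (hk : 1 ≤ k) (hkd : k ≤ d) (hfailed : #failed = 2) (hhelpers : helpers.card = d) :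
    2 * (d + 1) * Fintype.card ι ≤ (d + 2 - k) * P.bandwidth failed helpers := by
  classical
  set l := Fintype.card ι
  let A : Fin n → ℕ := fun i => ∑ j ∈ helpers, P.helperSize j i
  let B : Fin n → ℕ := fun i =>
    ∑ t ∈ range P.rounds, ∑ i' ∈ failed.erase i, P.exchangeSize t i' i
  have hband : P.bandwidth failed helpers = ∑ i ∈ failed, A i + ∑ i ∈ failed, B i := by
    simp only [CoopScheme.bandwidth, A, B]
    rw [Finset.sum_comm (s := range P.rounds)]
  have hone : ∀ i ∈ failed, d * l ≤ (d + 1 - k) * A i + d * B i := by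
    intro i hi
    -- Truncated subtraction is harmless: for `B i ≥ l` the bound holds trivially.
    have h := card_mul_le_mul_sum_of_forall_subset (fun j => P.helperSize j i) (l - B i)
      (d + 1 - k) (by omega) helpers (by omega) (by
        intro U hU hUc
        have hs := Finset.card_sdiff_of_subset hU
        have := hP.card_le_sum_of_card_sdiff hC hdisj hi (U := U) (by omega)
        exact Nat.sub_le_iff_le_add.2 this)
    rw [hhelpers, Nat.mul_sub] at h
    exact Nat.sub_le_iff_le_add.1 h
  have hone' : 2 * (d * l) ≤ (d + 1 - k) * ∑ i ∈ failed, A i + d * ∑ i ∈ failed, B i := by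
    have := Finset.sum_le_sum hone
    rwa [Finset.sum_const, hfailed, smul_eq_mul, Finset.sum_add_distrib, ← Finset.mul_sum,
      ← Finset.mul_sum] at this
  -- The cut uses `k - 2` helpers and so needs `k ≥ 2`; the factor `k - 1`, its weight in the final
  -- combination, makes `k = 1` trivial.
  have htwo : (k - 1) * (d * (2 * l)) ≤ (k - 1) * ((d + 2 - k) * ∑ i ∈ failed, A i) := by
    rcases Nat.eq_or_lt_of_le hk with rfl | hk2
    · simp
    · refine Nat.mul_le_mul_left _ ?_
      have h := card_mul_le_mul_sum_of_forall_subset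
        (fun j => ∑ i ∈ failed, P.helperSize j i) (2 * l)
        (d + 2 - k) (by omega) helpers (by omega) (by
          intro U hU hUc
          have hs := Finset.card_sdiff_of_subset hU
          have := hP.card_mul_le_sum_of_card_sdiff hC hdisj (U := U) (by omega)
          rwa [hfailed] at this)
      rwa [hhelpers, Finset.sum_comm] at h
  rw [hband]
  generalize ∑ i ∈ failed, A i = α at *
  generalize ∑ i ∈ failed, B i = β at *
  obtain ⟨m, rfl⟩ : ∃ m, k = m + 1 := ⟨k - 1, by omega⟩
  obtain ⟨e, rfl⟩ : ∃ e, d = m + 1 + e := ⟨d - (m + 1), by omega⟩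
  have h1 : m + 1 + e + 1 - (m + 1) = e + 1 := by omega
  have h2 : m + 1 + e + 2 - (m + 1) = e + 2 := by omega
  rw [h1] at hone'
  rw [h2] at htwo ⊢
  rw [Nat.add_sub_cancel] at htwo
  -- After multiplication by `d`, the claim is `d + 2 - k` times `hone'` plus `htwo`: the
  -- coefficients of `α` add up to `(d + 2 - k) * d`.
  refine Nat.le_of_mul_le_mul_left ?_ (by omega : 0 < m + 1 + e)
  have := Nat.mul_le_mul_left (e + 2) hone'
  linarith

end CutSet

theorem card_nodeIndex {n k d : ℕ} :
    Fintype.card (NodeIndex n k d) = (d + 2 - k) * (d + 1 - k) ^ n := by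
  simp

/-! ### The MDS property -/

section MDS

variable {F : Type*} [Field F] {n k d : ℕ} {lam : Fin n → Fin (d + 1 - k) → F}

theorem mem_replicatedCode {c : Fin n → NodeIndex n k d → F} :
    c ∈ replicatedCode n k d lam ↔ ∀ t < n - k, ∀ (b : Fin (d + 2 - k))
      (a : Fin n → Fin (d + 1 - k)), ∑ i, lam i (a i) ^ t * c i (b, a) = 0 :=
  Iff.rfl

/-- A codeword that vanishes on `k` nodes is zero. -/
theorem replicatedCode_eq_zero (hlam : Function.Injective (Function.uncurry lam))
    {c : Fin n → NodeIndex n k d → F} (hc : c ∈ replicatedCode n k d lam) {S : Finset (Fin n)}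
    (hS : #S = k) (h : ∀ i ∈ S, c i = 0) : c = 0 := by
  funext i ⟨b, a⟩
  by_cases hi : i ∈ S
  · rw [h i hi]; rfl
  refine eq_zero_of_sum_pow_mul_eq_zero (V := Sᶜ) (x := fun i => lam i (a i))
    (y := fun i => c i (b, a)) (r := n - k) ?_ ?_ ?_ i (Finset.mem_compl.2 hi)
  · exact fun i _ j _ hij => (eq_and_eq_of_uncurry_injective hlam hij).1
  · rw [Finset.card_compl, Fintype.card_fin, hS]
  · intro t ht
    rw [← hc t ht b a]
    refine Finset.sum_subset (Finset.subset_univ _) fun j _ hj => ?_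
    rw [h j (by simpa using hj), Pi.zero_apply, mul_zero]

/-- Restriction to `k` nodes is injective, which bounds the dimension above by `k * l`; the code is
cut out by `(n - k) * l` linear equations, which bounds it below. -/
theorem replicatedCode_isMDSArrayCode (hkn : k ≤ n)
    (hlam : Function.Injective (Function.uncurry lam)) :
    IsMDSArrayCode (replicatedCode n k d lam) k := by
  have hrec : ∀ S : Finset (Fin n), #S = k →
      ∀ c ∈ replicatedCode n k d lam, ∀ c' ∈ replicatedCode n k d lam,
      (∀ i ∈ S, c i = c' i) → c = c' := by
    intro S hS c hc c' hc' h
    refine sub_eq_zero.1 (replicatedCode_eq_zero hlam (Submodule.sub_mem _ hc hc') hS ?_)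
    exact fun i hi => sub_eq_zero.2 (h i hi)
  refine ⟨hkn, le_antisymm ?_ ?_, hrec⟩
  · obtain ⟨S, -, hS⟩ := Finset.exists_subset_card_eq
      (by simpa using hkn : k ≤ #(Finset.univ : Finset (Fin n)))
    let f : replicatedCode n k d lam →ₗ[F] (S → NodeIndex n k d → F) :=
      (LinearMap.funLeft F _ (Subtype.val : S → Fin n)).comp (replicatedCode n k d lam).subtype
    have hf : Function.Injective f := fun c c' hcc =>
      Subtype.ext (hrec S hS _ c.2 _ c'.2 fun i hi => congrFun hcc ⟨i, hi⟩)
    refine (LinearMap.finrank_le_finrank_of_injective hf).trans_eq ?_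
    rw [Module.finrank_pi_fintype]
    simp [hS]
  · let g : (Fin n → NodeIndex n k d → F) →ₗ[F] (Fin (n - k) → NodeIndex n k d → F) :=
      { toFun := fun c t x => ∑ i, lam i (x.2 i) ^ (t : ℕ) * c i x
        map_add' := fun c c' => by
          funext t x
          simp [mul_add, Finset.sum_add_distrib]
        map_smul' := fun r c => by
          funext t x
          simp [mul_left_comm _ r, Finset.mul_sum] }
    have hker : LinearMap.ker g = replicatedCode n k d lam := by
      ext c
      rw [LinearMap.mem_ker, mem_replicatedCode]
      constructor
      · intro h t ht b a
        exact congrFun (congrFun h ⟨t, ht⟩) (b, a)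
      · intro h
        funext t x
        exact h t t.2 x.1 x.2
    have hrank := LinearMap.finrank_range_add_finrank_ker g
    have hle := Submodule.finrank_le (LinearMap.range g)
    rw [hker] at hrank
    simp only [Module.finrank_pi_fintype, Module.finrank_self, Finset.sum_const, Finset.card_univ,
      smul_eq_mul, mul_one, Fintype.card_fin] at hrank hle
    rw [Nat.sub_mul] at hle
    have := Nat.mul_le_mul_right (Fintype.card (NodeIndex n k d)) hkn
    omega

end MDS

/-! ### The repair scheme -/

section Repair

variable {F : Type*} [Field F] {n k d : ℕ} [NeZero (d + 1 - k)]
  {lam : Fin n → Fin (d + 1 - k) → F}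

/-- The digit by which the replica `b` is shifted. -/
def shift (b : Fin (d + 2 - k)) : Fin (d + 1 - k) := Fin.ofNat (d + 1 - k) b

/-- The sums, over all replicas `b ≠ e`, of the coordinates `(b, a)` whose `p`-th digit is
shifted by `b`. -/
def mix (p : Fin n) (e : Fin (d + 2 - k)) :
    (NodeIndex n k d → F) →ₗ[F] ((Fin n → Fin (d + 1 - k)) → F) where
  toFun y a := ∑ b ∈ univ.erase e, y (b, Function.update a p (a p + shift b))
  map_add' y y' := by
    funext a
    simp only [Pi.add_apply, Finset.sum_add_distrib]
  map_smul' r y := by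
    funext a
    simp only [Pi.smul_apply, smul_eq_mul, Finset.mul_sum, RingHom.id_apply]

theorem mix_apply (p : Fin n) (e : Fin (d + 2 - k)) (y : NodeIndex n k d → F)
    (a : Fin n → Fin (d + 1 - k)) :
    mix p e y a = ∑ b ∈ univ.erase e, y (b, Function.update a p (a p + shift b)) :=
  rfl

theorem exists_update_shift_eq (p : Fin n) (b : Fin (d + 2 - k)) (a : Fin n → Fin (d + 1 - k)) :
    ∃ a', Function.update a' p (a' p + shift b) = a :=
  ⟨Function.update a p (a p - shift b), by simp⟩

/-- If the mixed data of `d` helper nodes vanish, then so do the coordinates `(b, a)` with `b ≠ e`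
of the node `p`, and the mixed data of all other nodes. -/
theorem eq_zero_of_mix_eq_zero (hkd : k ≤ d) (hlam : Function.Injective (Function.uncurry lam))
    {c : Fin n → NodeIndex n k d → F} (hc : c ∈ replicatedCode n k d lam)
    {p : Fin n} {e : Fin (d + 2 - k)}
    (he : Set.InjOn (shift (k := k) (d := d)) (univ.erase e : Finset _))
    {helpers : Finset (Fin n)} (hp : p ∉ helpers) (hcard : helpers.card = d)
    (h : ∀ j ∈ helpers, mix p e (c j) = 0) :
    (∀ b ≠ e, ∀ a, c p (b, a) = 0) ∧ ∀ i ≠ p, mix p e (c i) = 0 := by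
  classical
  have key : ∀ a : Fin n → Fin (d + 1 - k),
      (∀ b ≠ e, c p (b, Function.update a p (a p + shift b)) = 0) ∧
      ∀ i ∉ insert p helpers, mix p e (c i) a = 0 := by
    intro a
    have hV := eq_zero_of_sum_pow_mul_eq_zero
      (V := (univ.erase e).disjSum (insert p helpers)ᶜ)
      (x := Sum.elim (fun b => lam p (a p + shift b)) fun i => lam i (a i))
      (y := Sum.elim (fun b => c p (b, Function.update a p (a p + shift b)))
        fun i => mix p e (c i) a) (r := n - k) ?_ ?_ ?_
    · exact ⟨fun b hb => hV (Sum.inl b) (by simpa using hb),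
        fun i hi => hV (Sum.inr i) (by simpa using hi)⟩
    · rintro (b | i) hx (b' | i') hx' hxx
      · have hb : b ∈ univ.erase e := by simpa using hx
        have hb' : b' ∈ univ.erase e := by simpa using hx'
        rw [he hb hb' (add_left_cancel (eq_and_eq_of_uncurry_injective hlam hxx).2)]
      · have := (eq_and_eq_of_uncurry_injective hlam hxx).1
        simp [← this] at hx'
      · have := (eq_and_eq_of_uncurry_injective hlam hxx).1
        simp [this] at hx
      · rw [(eq_and_eq_of_uncurry_injective hlam hxx).1]
    -- The unknowns number `(d + 1 - k) + (n - d - 1) = n - k`, exactly the number of equations.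
    · have hins := Finset.card_insert_of_notMem hp
      have hle := Finset.card_le_univ (insert p helpers)
      rw [Fintype.card_fin] at hle
      rw [Finset.card_disjSum, Finset.card_erase_of_mem (Finset.mem_univ _), Finset.card_compl,
        Finset.card_univ, Fintype.card_fin, Fintype.card_fin]
      omega
    · intro t ht
      rw [Finset.sum_disjSum]
      simp only [Sum.elim_inl, Sum.elim_inr]
      -- Only the coefficient of node `p` depends on `b`; for every other node it factors out of the
      -- sum over `b`, leaving `mix`.
      have hsum : ∑ b ∈ univ.erase e, ∑ i, lam i (Function.update a p (a p + shift b) i) ^ t *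
          c i (b, Function.update a p (a p + shift b)) = 0 :=
        Finset.sum_eq_zero fun b _ => hc t ht b _
      rw [Finset.sum_comm, ← Finset.add_sum_erase _ _ (Finset.mem_univ p)] at hsum
      simp only [Function.update_self] at hsum
      rw [← hsum]
      congr 1
      have hterm : ∀ i ∈ univ.erase p,
          ∑ b ∈ univ.erase e, lam i (Function.update a p (a p + shift b) i) ^ t *
            c i (b, Function.update a p (a p + shift b)) = lam i (a i) ^ t * mix p e (c i) a := by
        intro i hi
        rw [mix_apply, Finset.mul_sum]
        refine Finset.sum_congr rfl fun b _ => ?_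
        rw [Function.update_of_ne (Finset.ne_of_mem_erase hi)]
      rw [Finset.sum_congr rfl hterm]
      refine Finset.sum_subset (fun i hi => ?_) fun i hi hi' => ?_
      · simp only [Finset.mem_compl, Finset.mem_insert, not_or] at hi
        exact Finset.mem_erase.2 ⟨hi.1, Finset.mem_univ _⟩
      · have : i ∈ helpers := by
          have hne := Finset.ne_of_mem_erase hi
          simpa [hne] using hi'
        rw [h i this, Pi.zero_apply, mul_zero]
  refine ⟨fun b hb a => ?_, fun i hi => ?_⟩
  · obtain ⟨a', rfl⟩ := exists_update_shift_eq p b a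
    exact (key a').1 b hb
  · by_cases hih : i ∈ helpers
    · exact h i hih
    · funext a
      exact (key a).2 i (by simp [hi, hih])

/-- The repair scheme with a single round of exchanges: the failed node `i` downloads the mixed
data of the helper nodes, with the replica `e i` left out, and sends to each other failed node the
mixed data of that node. -/
noncomputable def mixScheme (F : Type*) [Field F] (e : Fin n → Fin (d + 2 - k)) :
    CoopScheme F n (NodeIndex n k d) where
  helperSize _ _ := Fintype.card (Fin n → Fin (d + 1 - k))
  download _ i y := mix i (e i) y ∘ (Fintype.equivFin _).symm
  rounds := 1
  exchangeSize _ _ _ := Fintype.card (Fin n → Fin (d + 1 - k))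
  exchange _ i' i c := mix i' (e i') (c i) ∘ (Fintype.equivFin _).symm

/-- By linearity, what a failed node can compute is read off from differences of codewords with
equal views. Its downloads alone determine the message it sends, which gives causality. -/
theorem mixScheme_repairs (hkd : k ≤ d) (hlam : Function.Injective (Function.uncurry lam))
    {failed helpers : Finset (Fin n)} (hdisj : Disjoint failed helpers)
    (hfailed : #failed = 2) (hhelpers : helpers.card = d) {e : Fin n → Fin (d + 2 - k)}
    (he : ∀ i ∈ failed, Set.InjOn (shift (k := k) (d := d)) (univ.erase (e i) : Finset _))
    (hinj : Set.InjOn e failed) :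
    (mixScheme F e).Repairs (replicatedCode n k d lam) failed helpers := by
  have hcomp : ∀ f f' : (Fin n → Fin (d + 1 - k)) → F,
      f ∘ (Fintype.equivFin _).symm = f' ∘ (Fintype.equivFin _).symm → f = f' :=
    fun f f' h => (Fintype.equivFin _).symm.surjective.injective_comp_right h
  have hdown : ∀ i ∈ failed, ∀ c ∈ replicatedCode n k d lam, ∀ c' ∈ replicatedCode n k d lam,
      ∀ t, (mixScheme F e).SameView failed helpers t i c c' →
      (∀ b ≠ e i, ∀ a, (c - c') i (b, a) = 0) ∧ ∀ i' ≠ i, mix i (e i) ((c - c') i') = 0 := by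
    intro i hi c hc c' hc' t h
    refine eq_zero_of_mix_eq_zero hkd hlam (Submodule.sub_mem _ hc hc') (he i hi)
      (Finset.disjoint_left.1 hdisj hi) hhelpers fun j hj => ?_
    rw [Pi.sub_apply, map_sub, sub_eq_zero]
    exact hcomp _ _ (h.1 j hj)
  constructor
  · intro t _ i' hi' i _ hne c hc c' hc' h
    have := (hdown i' hi' c hc c' hc' t h).2 i hne
    rw [Pi.sub_apply, map_sub, sub_eq_zero] at this
    exact congrArg (· ∘ (Fintype.equivFin _).symm) this
  · intro i hi c hc c' hc' h
    have hown := (hdown i hi c hc c' hc' _ h).1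
    obtain ⟨i', hi', hne⟩ := Finset.exists_mem_ne (by omega : 1 < #failed) i
    have hmix : mix i' (e i') ((c - c') i) = 0 := by
      rw [Pi.sub_apply, map_sub, sub_eq_zero]
      exact hcomp _ _ (h.2 0 Nat.zero_lt_one i' hi' hne)
    rw [← sub_eq_zero]
    funext ⟨b, a⟩
    by_cases hb : b = e i
    -- In the received sum, replica `e i` occurs because `e i' ≠ e i`, and all its other terms are
    -- already known to vanish.
    · subst hb
      obtain ⟨a', rfl⟩ := exists_update_shift_eq i' (e i) a
      have := congrFun hmix a'
      rw [mix_apply, Finset.sum_eq_single (e i)] at this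
      · exact this
      · exact fun b _ hb => hown b hb _
      · intro hmem
        exact absurd (Finset.mem_erase.2
          ⟨fun h => hne (hinj hi hi' h).symm, Finset.mem_univ _⟩) hmem
    · exact hown b hb a

theorem bandwidth_mixScheme {failed helpers : Finset (Fin n)} (hfailed : #failed = 2)
    (hhelpers : helpers.card = d) (e : Fin n → Fin (d + 2 - k)) :
    (mixScheme F e).bandwidth failed helpers = 2 * (d + 1) * (d + 1 - k) ^ n := by
  have herase : ∀ i ∈ failed, ∑ _i' ∈ failed.erase i, (d + 1 - k) ^ n = (d + 1 - k) ^ n := by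
    intro i hi
    simp [Finset.card_erase_of_mem hi, hfailed]
  simp only [CoopScheme.bandwidth, mixScheme, Fintype.card_pi, Fintype.card_fin,
    Finset.prod_const, Finset.card_univ, Finset.range_one, Finset.sum_singleton]
  rw [Finset.sum_congr rfl herase]
  simp only [Finset.sum_const, smul_eq_mul, hfailed, hhelpers]
  ring

/-- Among `0, …, s` only `0` and `s` agree modulo `s`, so omitting either one makes the shifts
distinct. -/
theorem shift_injOn_erase (hkd : k ≤ d) {e : Fin (d + 2 - k)}
    (he : (e : ℕ) = 0 ∨ (e : ℕ) = d + 1 - k) :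
    Set.InjOn (shift (k := k) (d := d)) (univ.erase e : Finset _) := by
  intro b hb b' hb' h
  have hbe : (b : ℕ) ≠ e := fun hh => (Finset.mem_erase.1 hb).1 (Fin.ext hh)
  have hbe' : (b' : ℕ) ≠ e := fun hh => (Finset.mem_erase.1 hb').1 (Fin.ext hh)
  have hmod : (b : ℕ) % (d + 1 - k) = (b' : ℕ) % (d + 1 - k) := congrArg Fin.val h
  have hlt := b.2
  have hlt' := b'.2
  have hcases : ∀ x : ℕ, x < d + 2 - k →
      x % (d + 1 - k) = if x = d + 1 - k then 0 else x := by
    intro x hx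
    split_ifs with hxs
    · rw [hxs, Nat.mod_self]
    · exact Nat.mod_eq_of_lt (by omega)
  rw [hcases _ hlt, hcases _ hlt'] at hmod
  apply Fin.ext
  split_ifs at hmod <;> omega

end Repair

theorem isCoopRepairBandwidth_replicatedCode {F : Type*} [Field F] [Fintype F] {n k d : ℕ}
    (hk : 1 ≤ k) (hkd : k ≤ d) (hdn : d + 2 ≤ n) {lam : Fin n → Fin (d + 1 - k) → F}
    (hlam : Function.Injective (Function.uncurry lam)) {failed helpers : Finset (Fin n)}
    (hdisj : Disjoint failed helpers) (hfailed : #failed = 2) (hhelpers : helpers.card = d) :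
    IsCoopRepairBandwidth (replicatedCode n k d lam) failed helpers
      (2 * (d + 1) * (d + 1 - k) ^ n) := by
  have : NeZero (d + 1 - k) := ⟨by omega⟩
  constructor
  · obtain ⟨p, q, hpq, rfl⟩ := Finset.card_eq_two.1 hfailed
    -- The two failed nodes omit the two colliding replicas, one each; the value outside `{p, q}`
    -- plays no role.
    let e : Fin n → Fin (d + 2 - k) := fun i =>
      if i = p then ⟨0, by omega⟩ else ⟨d + 1 - k, by omega⟩
    have hval : ∀ i, (e i : ℕ) = 0 ∨ (e i : ℕ) = d + 1 - k := by
      intro i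
      by_cases hi : i = p <;> simp [e, hi]
    have hne : e p ≠ e q := by
      intro h
      have h' := congrArg Fin.val h
      simp only [e, if_true, if_neg hpq.symm] at h'
      omega
    refine ⟨mixScheme F e, mixScheme_repairs hkd hlam hdisj hfailed hhelpers
      (fun i _ => shift_injOn_erase hkd (hval i)) ?_, bandwidth_mixScheme hfailed hhelpers e⟩
    rw [Finset.coe_pair, Set.injOn_pair]
    exact fun h => absurd h hne
  · rintro m ⟨P, hP, rfl⟩
    have h := hP.cutSet_bound (replicatedCode_isMDSArrayCode (by omega) hlam) hdisj hk hkd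
      hfailed hhelpers
    -- The factor `d + 2 - k` of the node size cancels against the one in the cut-set bound.
    rw [card_nodeIndex, mul_left_comm] at h
    exact Nat.le_of_mul_le_mul_left h (by omega)

end CoopMSR

theorem mainTheorem2 {F : Type*} [Field F] [Fintype F] (n k d : ℕ)
    (hk : 1 ≤ k) (hkd : k ≤ d) (hdn : d + 2 ≤ n)
    (hF : (d + 1 - k) * n ≤ Fintype.card F) :
    (∃ lam : Fin n → Fin (d + 1 - k) → F, Function.Injective (Function.uncurry lam)) ∧
    ∀ lam : Fin n → Fin (d + 1 - k) → F, Function.Injective (Function.uncurry lam) →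
      Fintype.card (CoopMSR.NodeIndex n k d) = (d + 2 - k) * (d + 1 - k) ^ n ∧
      CoopMSR.IsMDSArrayCode (CoopMSR.replicatedCode n k d lam) k ∧
      (∀ failed helpers : Finset (Fin n), Disjoint failed helpers →
        failed.card = 2 → helpers.card = d →
        CoopMSR.IsCoopRepairBandwidth (CoopMSR.replicatedCode n k d lam) failed helpers
          (2 * (d + 1) * (d + 1 - k) ^ n)) ∧
      CoopMSR.IsCoopMSR (CoopMSR.replicatedCode n k d lam) k 2 d := by
  refine ⟨?_, fun lam hlam => ?_⟩
  · obtain ⟨f⟩ := Function.Embedding.nonempty_of_card_le (α := Fin n × Fin (d + 1 - k)) (β := F)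
      (by simpa [mul_comm] using hF)
    exact ⟨Function.curry f, by simpa using f.injective⟩
  · have hMDS := CoopMSR.replicatedCode_isMDSArrayCode (by omega : k ≤ n) hlam
    refine ⟨CoopMSR.card_nodeIndex, hMDS, ?_, hMDS, ?_⟩
    · exact fun failed helpers hdisj hfailed hhelpers =>
        CoopMSR.isCoopRepairBandwidth_replicatedCode hk hkd hdn hlam hdisj hfailed hhelpers
    · intro failed helpers hdisj hfailed hhelpers
      refine ⟨_, CoopMSR.isCoopRepairBandwidth_replicatedCode hk hkd hdn hlam hdisj hfailed
        hhelpers, ?_⟩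
      have hpos : (k : ℚ) ≤ d := by exact_mod_cast hkd
      rw [eq_div_iff (by push_cast; linarith), CoopMSR.card_nodeIndex]
      push_cast [Nat.cast_sub (by omega : k ≤ d + 2)]
      ring
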